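/- Setting. Let $\Gamma_\bullet=\{\Gamma_k:\mathcal M_{k-1}\to\mathcal M_k\}_{k\ge1}$ be a $0$-cell of $\mathbf{UC}$: a sequence of $*$-linear functors between finite semisimple C*-categories, each bi-faithful (the functor and its adjoint are faithful). Let $m_0\in\mathcal M_0$ be the orthogonal direct sum of a maximal set of mutually non-isomorphic simple objects, put $X_k:=\Gamma_k\cdots\Gamma_1m_0\in\mathcal M_k$ (with $X_0=m_0$), and let $A_k:=\mathrm{End}(X_k)$. Let $(Q_\bullet,W_\bullet,m_\bullet,i_\bullet)$ be a Q-system in $\mathbf{UC}(\Gamma_\bullet,\Gamma_\bullet)$. Thus $Q_k:\mathcal M_k\to\mathcal M_k$ ($k\ge 0$) are $*$-linear bi-faithful functors, $W_k:\Gamma_kQ_{k-1}\to Q_k\Gamma_k$ ($k\ge1$) are natural unitaries, and $m_k:Q_kQ_k\to Q_k$, $i_k:\mathrm{id}_{\mathcal M_k}\to Q_k$ are natural transformations such that for all large $k$: (a) exchange relations: for every object $x$ of $\mathcal M_k$, $$(W_{k+1})_x\circ\Gamma_{k+1}((m_k)_x)=(m_{k+1})_{\Gamma_{k+1}x}\circ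 Q_{k+1}((W_{k+1})_x)\circ(W_{k+1})_{Q_kx},\qquad (W_{k+1})_x\circ\Gamma_{k+1}((i_k)_x)=(i_{k+1})_{\Gamma_{k+1}x};$$ (b) Q-system axioms, with $m=m_k$, $i=i_k$, $1=\mathrm{id}_{Q_k}$: $m(m\boxtimes1)=m(1\boxtimes m)$; $m(i\boxtimes1)=1=m(1\boxtimes i)$; $(m\boxtimes1)(1\boxtimes m^*)=m^*m=(1\boxtimes m)(m^*\boxtimes1)$; $mm^*=1$. Fix $l\in\mathbb N$ such that (a) and (b) hold for all $k\ge l$. For $k\ge l$ let $H_k:=\mathcal M_k(X_k,Q_kX_k)$. It is a unital C*-algebra with product $\xi\cdot\eta=(m_k)_{X_k}\circ Q_k(\xi)\circ\eta$, involution $\xi^\dagger=Q_k(\xi^*)\circ(m_k)_{X_k}^*\circ(i_k)_{X_k}$ and unit $(i_k)_{X_k}$, and it carries the right $A_k$-valued inner product $\langle\xi,\eta\rangle_{A_k}=\eta^*\circ\xi$. Let $d_{Q_k}=i_k^*\circ i_k\in\mathrm{End}(\mathrm{id}_{\mathcal M_k})$, and let $d_{Q_k}^{-1}:=f(d_{Q_k})$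 by functional calculus, where $f(t)=t^{-1}$ for $t\ne0$ and $f(0)=0$. Lemma. For each $k\ge l$: 1. The map $\tilde i_k:A_k\to H_k$, $\tilde i_k(a)=(i_k)_{X_k}\circ a$, is a unital inclusion of C*-algebras (an injective unital $*$-homomorphism). 2. The map $E_k:H_k\to A_k$, $E_k(\xi)=(d_{Q_k}^{-1})_{X_k}\circ(i_k)_{X_k}^*\circ\xi$, is a conditional expectation with respect to $\tilde i_k$ (a positive linear $A_k$-$A_k$-bimodule map with $E_k\circ\tilde i_k=\mathrm{id}_{A_k}$). It is faithful (if $x\ge0$ and $E_k(x)=0$ then $x=0$) and of finite index (there is $K>0$ with $x\le K\,\tilde i_k(E_k(x))$ for all $x\ge 0$ in $H_k$). 3. For all $\xi,\eta\in H_k$, $E_k(\eta^\dagger\cdot\xi)=(d_{Q_k}^{-1})_{X_k}\circ\langle\xi,\eta\rangle_{A_k}$. -/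

import Mathlib

open CategoryTheory

universe v u v' u'

namespace UC

/-! ### C*-categories -/

/-- A C*-category: a `ℂ`-linear category with a conjugate-linear involution `dagger` on morphisms
and complete submultiplicative norms on the morphism spaces such that `‖f* ∘ f‖ = ‖f‖²` and
`f* ∘ f` is a positive element of the C*-algebra `End X` for each `f : X ⟶ Y`. -/
class CStarCategory (C : Type u) [Category.{v} C] [Preadditive C] [Linear ℂ C] where
  dagger : ∀ {X Y : C}, (X ⟶ Y) → (Y ⟶ X)
  dagger_dagger : ∀ {X Y : C} (f : X ⟶ Y), dagger (dagger f) = f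
  dagger_comp : ∀ {X Y Z : C} (f : X ⟶ Y) (g : Y ⟶ Z), dagger (f ≫ g) = dagger g ≫ dagger f
  dagger_add : ∀ {X Y : C} (f g : X ⟶ Y), dagger (f + g) = dagger f + dagger g
  dagger_smul : ∀ {X Y : C} (c : ℂ) (f : X ⟶ Y), dagger (c • f) = (star c) • dagger f
  homNorm : ∀ {X Y : C}, (X ⟶ Y) → ℝ
  homNorm_nonneg : ∀ {X Y : C} (f : X ⟶ Y), 0 ≤ homNorm f
  homNorm_eq_zero : ∀ {X Y : C} (f : X ⟶ Y), homNorm f = 0 ↔ f = 0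
  homNorm_add_le : ∀ {X Y : C} (f g : X ⟶ Y), homNorm (f + g) ≤ homNorm f + homNorm g
  homNorm_smul : ∀ {X Y : C} (c : ℂ) (f : X ⟶ Y), homNorm (c • f) = ‖c‖ * homNorm f
  homNorm_comp_le : ∀ {X Y Z : C} (f : X ⟶ Y) (g : Y ⟶ Z),
    homNorm (f ≫ g) ≤ homNorm f * homNorm g
  homNorm_comp_dagger : ∀ {X Y : C} (f : X ⟶ Y), homNorm (f ≫ dagger f) = homNorm f * homNorm f
  complete : ∀ {X Y : C} (f : ℕ → (X ⟶ Y)),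
    (∀ ε : ℝ, 0 < ε → ∃ N, ∀ p ≥ N, ∀ q ≥ N, homNorm (f p - f q) < ε) →
      ∃ g : X ⟶ Y, ∀ ε : ℝ, 0 < ε → ∃ N, ∀ p ≥ N, homNorm (f p - g) < ε
  comp_dagger_pos : ∀ {X Y : C} (f : X ⟶ Y), ∃ g : X ⟶ X, f ≫ dagger f = g ≫ dagger g

open CStarCategory

section Categories

variable (C : Type u) [Category.{v} C] [Preadditive C] [Linear ℂ C] [CStarCategory C]

/-- A finite semisimple C*-category: finite-dimensional morphism spaces, a zero object, orthogonal
direct sums, splitting of (orthogonal) projections, and finitely many simple objects up to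
isomorphism. -/
class FiniteSemisimple : Prop where
  finite_hom : ∀ X Y : C, FiniteDimensional ℂ (X ⟶ Y)
  exists_zero : ∃ Z : C, Limits.IsZero Z
  exists_sum : ∀ X Y : C, ∃ (Z : C) (s : X ⟶ Z) (t : Y ⟶ Z), s ≫ dagger s = 𝟙 X ∧
    t ≫ dagger t = 𝟙 Y ∧ dagger s ≫ s + dagger t ≫ t = 𝟙 Z
  split : ∀ (X : C) (p : X ⟶ X), p ≫ p = p → dagger p = p →
    ∃ (Y : C) (s : Y ⟶ X), s ≫ dagger s = 𝟙 Y ∧ dagger s ≫ s = p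
  finite_simples : ∃ (n : ℕ) (x : Fin n → C), ∀ X : C, Simple X → ∃ j, Nonempty (X ≅ x j)

variable {C}

/-- `m₀` is the (orthogonal) direct sum of a maximal set of mutually non-isomorphic simple
objects. -/
def IsSumOfAllSimples (m₀ : C) : Prop :=
  ∃ (n : ℕ) (x : Fin n → C) (s : ∀ j, x j ⟶ m₀),
    (∀ j, Simple (x j)) ∧
    (∀ j j', j ≠ j' → IsEmpty (x j ≅ x j')) ∧
    (∀ X : C, Simple X → ∃ j, Nonempty (X ≅ x j)) ∧
    (∀ j, s j ≫ dagger (s j) = 𝟙 (x j)) ∧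
    (∀ j j', j ≠ j' → s j ≫ dagger (s j') = 0) ∧
    ∑ j, dagger (s j) ≫ s j = 𝟙 m₀

theorem dagger_id (X : C) : dagger (𝟙 X) = 𝟙 X := by
  have h := dagger_comp (dagger (𝟙 X)) (𝟙 X)
  rw [Category.comp_id, dagger_dagger, Category.comp_id] at h
  exact h.symm

theorem homNorm_sub_comm {X Y : C} (f g : X ⟶ Y) : homNorm (f - g) = homNorm (g - f) := by
  have h := homNorm_smul (-1 : ℂ) (g - f)
  simpa using h

theorem homNorm_dagger {X Y : C} (f : X ⟶ Y) : homNorm (dagger f) = homNorm f := by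
  have key : ∀ {X Y : C} (f : X ⟶ Y), homNorm f ≤ homNorm (dagger f) := by
    intro X Y f
    have h1 := homNorm_comp_le f (dagger f)
    rw [homNorm_comp_dagger] at h1
    by_contra! h
    nlinarith [homNorm_nonneg f, homNorm_nonneg (dagger f)]
  refine le_antisymm ?_ (key f)
  simpa [dagger_dagger] using key (dagger f)

/-! ### The C*-algebra `End X` (with multiplication `a * b = a ∘ b`) -/

noncomputable instance (X : C) : NormedRing (End X) where
  toRing := inferInstance
  norm := fun f => homNorm (X := X) (Y := X) f
  dist := fun f g => homNorm (X := X) (Y := X) (f - g)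
  dist_self := fun f => by
    rw [sub_self]; exact (homNorm_eq_zero _).2 rfl
  dist_comm := fun f g => homNorm_sub_comm (C := C) (X := X) (Y := X) f g
  dist_triangle := fun f g h => by
    have := homNorm_add_le (X := X) (Y := X) (f - g) (g - h)
    rwa [show ((f - g : X ⟶ X) + (g - h) : X ⟶ X) = f - h from sub_add_sub_cancel _ _ _] at this
  eq_of_dist_eq_zero := fun {f g} h => sub_eq_zero.1 ((homNorm_eq_zero _).1 h)
  dist_eq := fun f g => by
    change homNorm (X := X) (Y := X) (f - g) = homNorm (X := X) (Y := X) (-f + g)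
    rw [homNorm_sub_comm, neg_add_eq_sub]
  norm_mul_le := fun f g => by
    have := homNorm_comp_le (X := X) (Y := X) (Z := X) g f
    rwa [mul_comm] at this

noncomputable instance (X : C) : NormedAlgebra ℂ (End X) where
  toAlgebra := inferInstance
  norm_smul_le := fun c f => (homNorm_smul (X := X) (Y := X) c f).le

noncomputable instance (X : C) : StarRing (End X) where
  star := fun f => dagger (X := X) (Y := X) f
  star_involutive := fun f => dagger_dagger (X := X) (Y := X) f
  star_mul := fun f g => dagger_comp (X := X) (Y := X) (Z := X) g f
  star_add := fun f g => dagger_add (X := X) (Y := X) f g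

instance (X : C) : StarModule ℂ (End X) where
  star_smul := fun c f => dagger_smul (X := X) (Y := X) c f

instance (X : C) : CStarRing (End X) where
  norm_mul_self_le := fun f => (homNorm_comp_dagger (X := X) (Y := X) f).ge

instance (X : C) : CompleteSpace (End X) :=
  Metric.complete_of_cauchySeq_tendsto fun f hf => by
    obtain ⟨g, hg⟩ := CStarCategory.complete (X := X) (Y := X) f (Metric.cauchySeq_iff.1 hf)
    exact ⟨g, Metric.tendsto_atTop.2 hg⟩

noncomputable instance (X : C) : CStarAlgebra (End X) where

/-! ### `*`-linear and bi-faithful functors -/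

variable {D : Type u'} [Category.{v'} D] [Preadditive D] [Linear ℂ D] [CStarCategory D]

/-- A `*`-linear functor. -/
structure IsStarLinear (F : C ⥤ D) : Prop where
  map_add : ∀ {X Y : C} (f g : X ⟶ Y), F.map (f + g) = F.map f + F.map g
  map_smul : ∀ {X Y : C} (c : ℂ) (f : X ⟶ Y), F.map (c • f) = c • F.map f
  map_dagger : ∀ {X Y : C} (f : X ⟶ Y), F.map (dagger f) = dagger (F.map f)

end Categories

/-- A functor is bi-faithful if both it and its adjoint are faithful. (A `*`-linear functor between
finite semisimple C*-categories has an adjoint, unique up to isomorphism; it is two-sided, by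
taking daggers of unit and counit, so it does not matter that a right adjoint is used here.) -/
def BiFaithful {C : Type u} [Category.{v} C] {D : Type u'} [Category.{v'} D] (F : C ⥤ D) : Prop :=
  F.Faithful ∧ ∃ G : D ⥤ C, Nonempty (F ⊣ G) ∧ G.Faithful

/-! ### 0-cells, 1-cells, and representatives of 2-cells of `UC` -/

section Cells

/-- A 0-cell: a sequence of `*`-linear bi-faithful functors `Γ k : M k ⥤ M (k + 1)` between finite
semisimple C*-categories. -/
structure ZeroCell (M : ℕ → Type u) [∀ k, Category.{v} (M k)] [∀ k, Preadditive (M k)]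
    [∀ k, Linear ℂ (M k)] [∀ k, CStarCategory (M k)] [∀ k, FiniteSemisimple (M k)] where
  functor : ∀ k, M k ⥤ M (k + 1)
  starLinear : ∀ k, IsStarLinear (functor k)
  biFaithful : ∀ k, BiFaithful (functor k)

variable {M : ℕ → Type u} [∀ k, Category.{v} (M k)] [∀ k, Preadditive (M k)]
  [∀ k, Linear ℂ (M k)] [∀ k, CStarCategory (M k)] [∀ k, FiniteSemisimple (M k)]

/-- The object `Γ_k ⋯ Γ_1 m₀` of `M k`. -/
def ZeroCell.obj (Γ : ZeroCell M) (m₀ : M 0) : ∀ k, M k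
  | 0 => m₀
  | k + 1 => (Γ.functor k).obj (ZeroCell.obj Γ m₀ k)

variable {N : ℕ → Type u} [∀ k, Category.{v} (N k)] [∀ k, Preadditive (N k)]
  [∀ k, Linear ℂ (N k)] [∀ k, CStarCategory (N k)] [∀ k, FiniteSemisimple (N k)]
variable {P : ℕ → Type u} [∀ k, Category.{v} (P k)] [∀ k, Preadditive (P k)]
  [∀ k, Linear ℂ (P k)] [∀ k, CStarCategory (P k)] [∀ k, FiniteSemisimple (P k)]

/-- A 1-cell from `Γ` to `Δ`: `*`-linear bi-faithful functors `Λ_k : M k ⥤ N k` together with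
natural unitaries `Δ_{k+1} Λ_k ⟶ Λ_{k+1} Γ_{k+1}` (composition of functors written from right
to left). -/
structure OneCell (Γ : ZeroCell M) (Δ : ZeroCell N) where
  functor : ∀ k, M k ⥤ N k
  starLinear : ∀ k, IsStarLinear (functor k)
  biFaithful : ∀ k, BiFaithful (functor k)
  conn : ∀ k, functor k ⋙ Δ.functor k ⟶ Γ.functor k ⋙ functor (k + 1)
  conn_dagger : ∀ k (x : M k), (conn k).app x ≫ dagger ((conn k).app x) = 𝟙 _
  dagger_conn : ∀ k (x : M k), dagger ((conn k).app x) ≫ (conn k).app x = 𝟙 _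

/-- The identity 1-cell. -/
def OneCell.one (Γ : ZeroCell M) : OneCell Γ Γ where
  functor := fun k => 𝟭 (M k)
  starLinear := fun _ => ⟨fun _ _ => rfl, fun _ _ => rfl, fun _ => rfl⟩
  biFaithful := fun _ => ⟨inferInstance, 𝟭 _, ⟨Adjunction.id⟩, inferInstance⟩
  conn := fun k => { app := fun x => 𝟙 ((Γ.functor k).obj x) }
  conn_dagger := fun k x => by
    change 𝟙 ((Γ.functor k).obj x) ≫ dagger (𝟙 ((Γ.functor k).obj x)) = _
    rw [dagger_id]; exact Category.comp_id _
  dagger_conn := fun k x => by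
    change dagger (𝟙 ((Γ.functor k).obj x)) ≫ 𝟙 ((Γ.functor k).obj x) = _
    rw [dagger_id]; exact Category.comp_id _

/-- The tensor product `Ω ⊠ Λ` of 1-cells, with functors `Ω_k Λ_k`. -/
def OneCell.tensor {Γ : ZeroCell M} {Δ : ZeroCell N} {E : ZeroCell P}
    (Ω : OneCell Δ E) (Λ : OneCell Γ Δ) : OneCell Γ E where
  functor := fun k => Λ.functor k ⋙ Ω.functor k
  starLinear := fun k =>
    ⟨fun f g => by simp [(Λ.starLinear k).map_add, (Ω.starLinear k).map_add],
      fun c f => by simp [(Λ.starLinear k).map_smul, (Ω.starLinear k).map_smul],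
      fun f => by simp [(Λ.starLinear k).map_dagger, (Ω.starLinear k).map_dagger]⟩
  biFaithful := fun k => by
    obtain ⟨h1, G1, ⟨a1⟩, h1'⟩ := Λ.biFaithful k
    obtain ⟨h2, G2, ⟨a2⟩, h2'⟩ := Ω.biFaithful k
    exact ⟨inferInstance, G2 ⋙ G1, ⟨a1.comp a2⟩, inferInstance⟩
  conn := fun k =>
    { app := fun x => (Ω.conn k).app ((Λ.functor k).obj x) ≫
        (Ω.functor (k + 1)).map ((Λ.conn k).app x)
      naturality := fun x y f => by
        have h1 := (Ω.conn k).naturality ((Λ.functor k).map f)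
        have h2 := congrArg (Ω.functor (k + 1)).map ((Λ.conn k).naturality f)
        simp only [Functor.comp_map, Functor.map_comp] at h1 h2 ⊢
        rw [← Category.assoc, h1, Category.assoc, h2, Category.assoc] }
  conn_dagger := fun k x => by
    simp only [dagger_comp, ← (Ω.starLinear (k + 1)).map_dagger, Category.assoc]
    rw [← Functor.map_comp_assoc, Λ.conn_dagger]
    simpa using Ω.conn_dagger k ((Λ.functor k).obj x)
  dagger_conn := fun k x => by
    simp only [dagger_comp, ← (Ω.starLinear (k + 1)).map_dagger, Category.assoc]
    rw [← Category.assoc (dagger ((Ω.conn k).app _)), Ω.dagger_conn]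
    erw [Category.id_comp]
    rw [← Functor.map_comp, Λ.dagger_conn]
    exact CategoryTheory.Functor.map_id _ _

/-- The exchange relation for `η : Λ_k ⟶ Ω_k` and `κ : Λ_{k+1} ⟶ Ω_{k+1}`. -/
def Exchange {Γ : ZeroCell M} {Δ : ZeroCell N} (Λ Ω : OneCell Γ Δ) (k : ℕ)
    (η : Λ.functor k ⟶ Ω.functor k) (κ : Λ.functor (k + 1) ⟶ Ω.functor (k + 1)) : Prop :=
  ∀ x : M k, (Δ.functor k).map (η.app x) ≫ (Ω.conn k).app x =
    (Λ.conn k).app x ≫ κ.app ((Γ.functor k).obj x)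

end Cells

/-! ### Q-systems -/

section QSystems

variable {C : Type u} [Category.{v} C] [Preadditive C] [Linear ℂ C] [CStarCategory C]

/-- `(Q, m, i)` is a Q-system in the 2-category of C*-categories, `*`-linear functors and natural
transformations. The component at `X` of `m ⊠ id_Q` is `m_{Q X}`, that of `id_Q ⊠ m` is `Q m_X`. -/
structure IsQSystem (Q : C ⥤ C) (m : Q ⋙ Q ⟶ Q) (i : 𝟭 C ⟶ Q) : Prop where
  starLinear : IsStarLinear Q
  assoc : ∀ X, m.app (Q.obj X) ≫ m.app X = Q.map (m.app X) ≫ m.app X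
  unit_left : ∀ X, i.app (Q.obj X) ≫ m.app X = 𝟙 (Q.obj X)
  unit_right : ∀ X, Q.map (i.app X) ≫ m.app X = 𝟙 (Q.obj X)
  frobenius_left : ∀ X,
    Q.map (dagger (m.app X)) ≫ m.app (Q.obj X) = m.app X ≫ dagger (m.app X)
  frobenius_right : ∀ X,
    dagger (m.app (Q.obj X)) ≫ Q.map (m.app X) = m.app X ≫ dagger (m.app X)
  separable : ∀ X, dagger (m.app X) ≫ m.app X = 𝟙 (Q.obj X)

/-- The space `H = C(X, Q X)` attached to a Q-system and an object `X`. -/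
def HSpace {Q : C ⥤ C} {m : Q ⋙ Q ⟶ Q} {i : 𝟭 C ⟶ Q} (_ : IsQSystem Q m i) (X : C) : Type v :=
  X ⟶ Q.obj X

namespace HSpace

variable {Q : C ⥤ C} {m : Q ⋙ Q ⟶ Q} {i : 𝟭 C ⟶ Q} {S : IsQSystem Q m i} {X : C}

/-- A morphism `X ⟶ Q X` as an element of `H`. -/
def of (S : IsQSystem Q m i) {X : C} (f : X ⟶ Q.obj X) : HSpace S X := f

/-- The morphism `X ⟶ Q X` underlying an element of `H`. -/
def hom (ξ : HSpace S X) : X ⟶ Q.obj X := ξ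

instance : AddCommGroup (HSpace S X) := inferInstanceAs (AddCommGroup (X ⟶ Q.obj X))
instance : Module ℂ (HSpace S X) := inferInstanceAs (Module ℂ (X ⟶ Q.obj X))

/-- `ξ · η = m_X ∘ Q ξ ∘ η`. -/
instance : Mul (HSpace S X) := ⟨fun ξ η => of S (hom η ≫ Q.map (hom ξ) ≫ m.app X)⟩

/-- The unit is `i_X`. -/
instance : One (HSpace S X) := ⟨of S (i.app X)⟩

/-- `ξ† = Q(ξ*) ∘ m_X* ∘ i_X`. -/
instance : Star (HSpace S X) :=
  ⟨fun ξ => of S (i.app X ≫ dagger (m.app X) ≫ Q.map (dagger (hom ξ)))⟩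

/-- `ξ ↦ m_X ∘ Q ξ`, which embeds `H` into the C*-algebra `End (Q X)`. -/
def emb (ξ : HSpace S X) : End (Q.obj X) := Q.map (hom ξ) ≫ m.app X

theorem emb_injective : Function.Injective (emb : HSpace S X → End (Q.obj X)) := by
  have key : ∀ ξ : HSpace S X, hom ξ = i.app X ≫ (emb ξ : Q.obj X ⟶ Q.obj X) := fun ξ => by
    have h := i.naturality (hom ξ)
    simp only [Functor.id_map] at h
    change hom ξ = i.app X ≫ Q.map (hom ξ) ≫ m.app X
    rw [← Category.assoc, ← h, Category.assoc, S.unit_left]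
    exact (Category.comp_id _).symm
  intro ξ η h
  change hom ξ = hom η
  rw [key, key, h]

theorem emb_add (ξ η : HSpace S X) : emb (ξ + η) = emb ξ + emb η := by
  change Q.map (hom ξ + hom η) ≫ m.app X = _
  rw [S.starLinear.map_add, Preadditive.add_comp]; rfl

theorem emb_smul (c : ℂ) (ξ : HSpace S X) : emb (c • ξ) = c • emb ξ := by
  change Q.map (c • hom ξ) ≫ m.app X = _
  rw [S.starLinear.map_smul, Linear.smul_comp]; rfl

theorem emb_one : emb (1 : HSpace S X) = 1 := S.unit_right X

theorem emb_mul (ξ η : HSpace S X) : emb (ξ * η) = emb ξ * emb η := by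
  change Q.map (hom η ≫ Q.map (hom ξ) ≫ m.app X) ≫ m.app X =
    (Q.map (hom η) ≫ m.app X) ≫ Q.map (hom ξ) ≫ m.app X
  have h := m.naturality (hom ξ)
  simp only [Functor.comp_map] at h
  simp only [Functor.map_comp, Category.assoc]
  rw [← S.assoc, reassoc_of% h]

theorem emb_star (ξ : HSpace S X) : emb (star ξ) = star (emb ξ) := by
  change Q.map (i.app X ≫ dagger (m.app X) ≫ Q.map (dagger (hom ξ))) ≫ m.app X =
    dagger (Q.map (hom ξ) ≫ m.app X)
  have h := m.naturality (dagger (hom ξ))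
  simp only [Functor.comp_map] at h
  simp only [Functor.map_comp, Category.assoc]
  rw [h, dagger_comp, ← S.starLinear.map_dagger, ← Category.assoc (Q.map (dagger (m.app X))),
    S.frobenius_left, Category.assoc, ← Category.assoc (Q.map (i.app X)), S.unit_right]
  exact Category.id_comp _

theorem emb_zero : emb (0 : HSpace S X) = 0 := by
  have h := emb_smul (0 : ℂ) (0 : HSpace S X)
  rwa [zero_smul, zero_smul] at h

instance : Ring (HSpace S X) where
  toAddCommGroup := inferInstance
  mul := (· * ·)
  one := 1
  left_distrib := fun a b c => emb_injective (by simp only [emb_mul, emb_add, mul_add])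
  right_distrib := fun a b c => emb_injective (by simp only [emb_mul, emb_add, add_mul])
  zero_mul := fun a => emb_injective (by simp only [emb_mul, emb_zero, zero_mul])
  mul_zero := fun a => emb_injective (by simp only [emb_mul, emb_zero, mul_zero])
  mul_assoc := fun a b c => emb_injective (by simp only [emb_mul, mul_assoc])
  one_mul := fun a => emb_injective (by simp only [emb_mul, emb_one, one_mul])
  mul_one := fun a => emb_injective (by simp only [emb_mul, emb_one, mul_one])

noncomputable instance : Algebra ℂ (HSpace S X) :=
  Algebra.ofModule
    (fun c a b => emb_injective (by simp only [emb_mul, emb_smul, smul_mul_assoc]))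
    (fun c a b => emb_injective (by simp only [emb_mul, emb_smul, mul_smul_comm]))

/-- `emb` as a homomorphism of algebras. -/
noncomputable def embHom (S : IsQSystem Q m i) (X : C) : HSpace S X →ₐ[ℂ] End (Q.obj X) :=
  AlgHom.ofLinearMap { toFun := emb, map_add' := emb_add, map_smul' := emb_smul } emb_one emb_mul

noncomputable instance : StarRing (HSpace S X) where
  star_involutive := fun a => emb_injective (by simp only [emb_star, star_star])
  star_mul := fun a b => emb_injective (by simp only [emb_star, emb_mul, star_mul])
  star_add := fun a b => emb_injective (by simp only [emb_star, emb_add, star_add])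

instance : StarModule ℂ (HSpace S X) where
  star_smul := fun c a => emb_injective (by simp only [emb_star, emb_smul, star_smul])

noncomputable instance : NormedRing (HSpace S X) :=
  NormedRing.induced (HSpace S X) (End (Q.obj X)) (embHom S X) emb_injective

noncomputable instance : NormedAlgebra ℂ (HSpace S X) :=
  NormedAlgebra.induced ℂ (HSpace S X) (End (Q.obj X)) (embHom S X)

instance : CStarRing (HSpace S X) where
  norm_mul_self_le := fun ξ => by
    change ‖emb ξ‖ * ‖emb ξ‖ ≤ ‖emb (star ξ * ξ)‖
    rw [emb_mul, emb_star]
    exact CStarRing.norm_mul_self_le (emb ξ)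

instance [FiniteSemisimple C] : CompleteSpace (HSpace S X) :=
  have : FiniteDimensional ℂ (HSpace S X) := FiniteSemisimple.finite_hom X (Q.obj X)
  FiniteDimensional.complete ℂ (HSpace S X)

/-- `H` is a unital C*-algebra. -/
noncomputable instance [FiniteSemisimple C] : CStarAlgebra (HSpace S X) where

/-- The unit map `End X → H`, `a ↦ i_X ∘ a` (which is also `Q a ∘ i_X`). -/
def unitMap (S : IsQSystem Q m i) (X : C) (a : End X) : HSpace S X :=
  of S ((a : X ⟶ X) ≫ i.app X)

/-- The right `End X`-valued inner product `⟨ξ, ζ⟩ = ζ* ∘ ξ` on `H`. -/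
def inner (ξ ζ : HSpace S X) : End X := hom ξ ≫ dagger (hom ζ)

end HSpace

/-- The component at `X` of `d_Q = i* ∘ i`, a natural endomorphism of the identity functor. -/
def dQ {Q : C ⥤ C} (i : 𝟭 C ⟶ Q) (X : C) : End X := i.app X ≫ dagger (i.app X)

/-- The component at `X` of `d_Q⁻¹ = f(d_Q)`, where `f(x) = x⁻¹` for `x ≠ 0` and `f(0) = 0`
(functional calculus in the C*-algebra `End X`; Lean's convention is `0⁻¹ = 0`). -/
noncomputable def dQInv {Q : C ⥤ C} (i : 𝟭 C ⟶ Q) (X : C) : End X :=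
  cfc (fun z : ℂ => z⁻¹) (dQ i X)

/-- `E(ξ) = d_Q⁻¹ · (i_X* ∘ ξ)`. -/
noncomputable def HSpace.condExp {Q : C ⥤ C} {m : Q ⋙ Q ⟶ Q} {i : 𝟭 C ⟶ Q}
    (S : IsQSystem Q m i) (X : C) (ξ : HSpace S X) : End X :=
  dQInv i X * End.of (HSpace.hom ξ ≫ dagger (i.app X))

end QSystems

/-! ### Q-systems in `UC` -/

section UCQSystems

variable {M : ℕ → Type u} [∀ k, Category.{v} (M k)] [∀ k, Preadditive (M k)]
  [∀ k, Linear ℂ (M k)] [∀ k, CStarCategory (M k)] [∀ k, FiniteSemisimple (M k)]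

/-- A 1-cell `Q : Γ ⟶ Γ` of `UC` with sequences `m k : Q_k Q_k ⟶ Q_k` and `i k : id ⟶ Q_k`
(that is, from `Q ⊠ Q`, respectively the identity 1-cell, to `Q`) satisfies the exchange relations and the Q-system axioms at level `k`. -/
structure QSystemAt {Γ : ZeroCell M} (Q : OneCell Γ Γ)
    (m : ∀ k, Q.functor k ⋙ Q.functor k ⟶ Q.functor k)
    (i : ∀ k, 𝟭 (M k) ⟶ Q.functor k) (k : ℕ) : Prop where
  exchange_mul : Exchange (Q.tensor Q) Q k (m k) (m (k + 1))
  exchange_unit : Exchange (OneCell.one Γ) Q k (i k) (i (k + 1))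
  isQSystem : IsQSystem (Q.functor k) (m k) (i k)

/-- A Q-system in `UC(Γ, Γ)`. A 2-cell of `UC` is a sequence of natural transformations that
eventually satisfies the exchange relation, modulo eventual equality, so the Q-system axioms
(equalities of 2-cells) amount to the same axioms at all large enough levels. -/
structure QSystem (Γ : ZeroCell M) where
  cell : OneCell Γ Γ
  mul : ∀ k, cell.functor k ⋙ cell.functor k ⟶ cell.functor k
  unit : ∀ k, 𝟭 (M k) ⟶ cell.functor k
  eventually : ∃ l, ∀ k ≥ l, QSystemAt cell mul unit k

end UCQSystems

/-! ### Conditional expectations -/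

section ConditionalExpectations

variable {A : Type u} {B : Type v} [CStarAlgebra A] [CStarAlgebra B]

/-- Positive elements of a C*-algebra. -/
def IsPositive (a : A) : Prop := ∃ c : A, a = star c * c

/-- `E : B → A` is a conditional expectation for the inclusion `ι : A → B`: a positive linear
`A`-`A`-bimodule map with `E ∘ ι = id`. -/
structure IsCondExp (ι : A →⋆ₐ[ℂ] B) (E : B → A) : Prop where
  map_add : ∀ x y, E (x + y) = E x + E y
  map_smul : ∀ (c : ℂ) x, E (c • x) = c • E x
  map_inclusion : ∀ a, E (ι a) = a
  bimodule : ∀ a x b, E (ι a * x * ι b) = a * E x * b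
  positive : ∀ x, IsPositive x → IsPositive (E x)

/-- `E` is faithful: `E x = 0` with `x` positive forces `x = 0`. -/
def IsFaithful (E : B → A) : Prop := ∀ x, IsPositive x → E x = 0 → x = 0

/-- `E` has finite index: there is a constant `K` with `x ≤ K · E x` for all positive `x`. -/
def HasFiniteIndex (ι : A →⋆ₐ[ℂ] B) (E : B → A) : Prop :=
  ∃ K : ℝ, 0 < K ∧ ∀ x, IsPositive x → IsPositive ((K : ℂ) • ι (E x) - x)

end ConditionalExpectations

end UC

/-!
The theorem concerns a single Q-system `(Q, m, i)` with `Q` faithful on a finite semisimple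
C*-category and a single object `X`.
The underlying tool is `HSpace.emb`, `ξ ↦ m_X ∘ Q ξ`, which embeds `H` into the C*-algebra
`End (Q X)` and turns the unit map `a ↦ i_X ∘ a` into `a ↦ Q a` (`HSpace.emb_unitMap`).

The element `d = d_Q` of `End X` is positive, and naturality of `i` and of its adjoint makes it
central. The unit law exhibits `Q (i_X)` as a split monomorphism, so `i_X` is a monomorphism since
`Q` is faithful, and multiplication by `d` is injective on the finite-dimensional algebra `End X`.
Hence `d` is invertible and the functional calculus `d_Q⁻¹` is its inverse, again central and
positive (`IsQSystem.isUnit_dQ`, `IsQSystem.dQInv_eq_inv`).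

The Frobenius and unit laws give `i_X* ∘ (η† · ξ) = η* ∘ ξ`
(`HSpace.hom_star_mul_comp_dagger_unit`), that is `E (η† · ξ) = d⁻¹ ⟨ξ, η⟩`. Positivity of `E` is
then positivity of a product of commuting positive elements, and faithfulness is the C*-identity.

For finite index, let `P = ⟨ξ, ξ⟩`. As `m_X` is a coisometry, the image of `ξ† · ξ` under `emb` is
at most `Q P`, and `P ≤ (‖d‖ + 1) d⁻¹ P`, so `K = ‖d‖ + 1` bounds `ξ† · ξ` by `K · E (ξ† · ξ)` inside
`End (Q X)`. Positivity descends to `H`, because injective `*`-homomorphisms preserve spectra of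
self-adjoint elements (`IsPositive.of_map`).
-/

namespace UC

/-! ### Positive elements of C*-algebras -/

section Positivity

variable {A : Type u} {B : Type v} [CStarAlgebra A] [CStarAlgebra B]

theorem isPositive_iff_spectrum (a : A) :
    IsPositive a ↔ IsSelfAdjoint a ∧ ∀ x ∈ spectrum ℝ a, 0 ≤ x := by
  let _ := CStarAlgebra.spectralOrder A
  have := CStarAlgebra.spectralOrderedRing A
  have h : IsPositive a ↔ 0 ≤ a := CStarAlgebra.nonneg_iff_eq_star_mul_self.symm
  rw [h]
  constructor
  · intro ha
    exact ⟨.of_nonneg ha, fun x hx => spectrum_nonneg_of_nonneg ha hx⟩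
  · rintro ⟨ha, hs⟩
    rwa [StarOrderedRing.nonneg_iff_spectrum_nonneg (R := ℝ) a]

theorem IsPositive.add {a b : A} (ha : IsPositive a) (hb : IsPositive b) :
    IsPositive (a + b) := by
  let _ := CStarAlgebra.spectralOrder A
  have := CStarAlgebra.spectralOrderedRing A
  exact CStarAlgebra.nonneg_iff_eq_star_mul_self.1
    (add_nonneg (CStarAlgebra.nonneg_iff_eq_star_mul_self.2 ha)
      (CStarAlgebra.nonneg_iff_eq_star_mul_self.2 hb))

theorem IsPositive.mul_of_commute {a b : A} (ha : IsPositive a) (hb : IsPositive b)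
    (h : Commute a b) : IsPositive (a * b) := by
  let _ := CStarAlgebra.spectralOrder A
  have := CStarAlgebra.spectralOrderedRing A
  exact CStarAlgebra.nonneg_iff_eq_star_mul_self.1
    (h.mul_nonneg (CStarAlgebra.nonneg_iff_eq_star_mul_self.2 ha)
      (CStarAlgebra.nonneg_iff_eq_star_mul_self.2 hb))

theorem IsPositive.isSelfAdjoint {a : A} (ha : IsPositive a) : IsSelfAdjoint a :=
  ((isPositive_iff_spectrum a).1 ha).1

theorem IsPositive.norm_smul_one_sub {a : A} (ha : IsPositive a) :
    IsPositive (((‖a‖ + 1 : ℝ) : ℂ) • (1 : A) - a) := by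
  let _ := CStarAlgebra.spectralOrder A
  have := CStarAlgebra.spectralOrderedRing A
  refine CStarAlgebra.nonneg_iff_eq_star_mul_self.1 (sub_nonneg.2 ?_)
  refine (ha.isSelfAdjoint.le_algebraMap_norm_self).trans ?_
  have h : (0 : A) ≤ 1 := by simp
  rw [Complex.coe_smul, Algebra.algebraMap_eq_smul_one, add_smul, one_smul]
  exact le_add_of_nonneg_right h

theorem IsPositive.of_mul_eq_one {d e : A} (hd : IsPositive d) (h : d * e = 1)
    (h' : e * d = 1) : IsPositive e := by
  have he : star e = e := by
    -- `star e` is also inverse to the self-adjoint `d`.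
    have h1 : star e * d = 1 := by
      have := congrArg star h
      rwa [star_mul, hd.isSelfAdjoint.star_eq, star_one] at this
    exact left_inv_eq_right_inv h1 h
  obtain ⟨g, rfl⟩ := hd
  exact ⟨g * e, by rw [star_mul, mul_assoc, ← mul_assoc (star g), h, he, mul_one]⟩

/-- If `e` is inverse to a positive `d` and both commute with a positive `p`, then
`p ≤ (‖d‖ + 1) • e * p`, since `d ≤ ‖d‖ + 1`. The summand `1` keeps the constant nonzero in the
zero algebra. -/
theorem IsPositive.smul_inv_mul_sub {d e p : A} (hd : IsPositive d) (hp : IsPositive p)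
    (h : d * e = 1) (h' : e * d = 1) (hdp : Commute d p) (hep : Commute e p) :
    IsPositive (((‖d‖ + 1 : ℝ) : ℂ) • (e * p) - p) := by
  have hK := hd.norm_smul_one_sub
  set K : ℂ := ((‖d‖ + 1 : ℝ) : ℂ)
  have hKp : Commute (K • (1 : A) - d) p := ((Commute.one_left p).smul_left K).sub_left hdp
  have hKe : Commute e (K • (1 : A) - d) :=
    ((Commute.one_right e).smul_right K).sub_right (h'.trans h.symm)
  have := (hd.of_mul_eq_one h h').mul_of_commute (hK.mul_of_commute hp hKp) (hKe.mul_right hep)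
  convert this using 1
  rw [sub_mul, mul_sub, ← mul_assoc e d, h', one_mul, smul_mul_assoc, one_mul, mul_smul_comm]

/-- An injective `*`-homomorphism preserves spectra of self-adjoint elements, hence reflects
positivity. -/
theorem IsPositive.of_map (φ : A →⋆ₐ[ℂ] B) (hφ : Function.Injective φ) {a : A}
    (h : IsPositive (φ a)) : IsPositive a := by
  rw [isPositive_iff_spectrum] at h ⊢
  have ha : IsSelfAdjoint a := hφ ((map_star φ a).trans h.1.star_eq)
  exact ⟨ha, by rw [← ha.map_spectrum_real φ hφ]; exact h.2⟩

end Positivity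

open CStarCategory

/-! ### Positive morphisms in C*-categories -/

section QSystems

theorem unit_naturality {C : Type u} [Category.{v} C] {Q : C ⥤ C} {i : 𝟭 C ⟶ Q} {X Y : C}
    (f : X ⟶ Y) : f ≫ i.app Y = i.app X ≫ Q.map f :=
  i.naturality f

variable {C : Type u} [Category.{v} C] [Preadditive C] [Linear ℂ C] [CStarCategory C]

theorem dagger_sub {X Y : C} (f g : X ⟶ Y) : dagger (f - g) = dagger f - dagger g := by
  rw [eq_sub_iff_add_eq, ← dagger_add, sub_add_cancel]

theorem eq_zero_of_comp_dagger {X Y : C} {f : X ⟶ Y} (h : f ≫ dagger f = 0) : f = 0 := by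
  have h1 := homNorm_comp_dagger f
  rw [h, (homNorm_eq_zero _).2 rfl] at h1
  exact (homNorm_eq_zero f).1 (mul_self_eq_zero.1 h1.symm)

/-- Multiplication in `End X` is `a * b = b ≫ a`, so `star g * g` is `g ≫ dagger g`. -/
theorem isPositive_comp_dagger {X Y : C} (f : X ⟶ Y) :
    IsPositive (A := End X) (f ≫ dagger f) := by
  obtain ⟨g, hg⟩ := comp_dagger_pos f
  exact ⟨g, hg⟩

/-- If `w` is a coisometry, then `w* ∘ w ≤ 1`; the inequality is conjugated by `f`. -/
theorem isPositive_comp_dagger_sub {X Y Z : C} (f : X ⟶ Y) (w : Y ⟶ Z)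
    (hw : dagger w ≫ w = 𝟙 Z) :
    IsPositive (A := End X) (f ≫ dagger f - (f ≫ w) ≫ dagger (f ≫ w)) := by
  set p : Y ⟶ Y := 𝟙 Y - w ≫ dagger w with hp
  have hpp : p ≫ dagger p = p := by
    have hd : dagger p = p := by
      rw [hp, dagger_sub, dagger_comp, dagger_dagger, dagger_id]
    rw [hd, hp, Preadditive.sub_comp, Preadditive.comp_sub, Preadditive.comp_sub,
      Category.assoc w, Category.assoc w, reassoc_of% hw]
    simp
  have h := isPositive_comp_dagger (f ≫ p)
  rw [dagger_comp, Category.assoc, ← Category.assoc p, hpp, hp] at h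
  simpa [dagger_comp] using h

theorem IsStarLinear.map_sub {D : Type u'} [Category.{v'} D] [Preadditive D] [Linear ℂ D]
    [CStarCategory D] {F : C ⥤ D} (hF : IsStarLinear F) {X Y : C} (f g : X ⟶ Y) :
    F.map (f - g) = F.map f - F.map g := by
  rw [eq_sub_iff_add_eq, ← hF.map_add, sub_add_cancel]

theorem IsStarLinear.isPositive_map {D : Type u'} [Category.{v'} D] [Preadditive D] [Linear ℂ D]
    [CStarCategory D] {F : C ⥤ D} (hF : IsStarLinear F) {X : C} {a : End X} (ha : IsPositive a) :
    IsPositive (A := End (F.obj X)) (F.map a) := by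
  obtain ⟨g, rfl⟩ := ha
  refine ⟨End.of (F.map g), ?_⟩
  exact (F.map_comp (X := X) (Y := X) (Z := X) g (dagger (X := X) (Y := X) g)).trans
    (congrArg (F.map (X := X) (Y := X) g ≫ ·) (hF.map_dagger (X := X) (Y := X) g))

variable {Q : C ⥤ C} {m : Q ⋙ Q ⟶ Q} {i : 𝟭 C ⟶ Q}

/-! ### The loop parameter `d_Q` -/

theorem IsStarLinear.dagger_unit_naturality (hQ : IsStarLinear Q) {X Y : C} (f : X ⟶ Y) :
    dagger (i.app X) ≫ f = Q.map f ≫ dagger (i.app Y) := by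
  have h := congrArg dagger (unit_naturality (i := i) (dagger f))
  rw [dagger_comp, dagger_comp, hQ.map_dagger, dagger_dagger, dagger_dagger] at h
  exact h

theorem isPositive_dQ (i : 𝟭 C ⟶ Q) (X : C) : IsPositive (dQ i X) :=
  isPositive_comp_dagger (i.app X)

theorem IsStarLinear.commute_dQ (hQ : IsStarLinear Q) (i : 𝟭 C ⟶ Q) {X : C} (a : End X) :
    Commute (dQ i X) a := by
  change (a : X ⟶ X) ≫ i.app X ≫ dagger (i.app X) = (i.app X ≫ dagger (i.app X)) ≫ (a : X ⟶ X)
  have h1 := unit_naturality (i := i) (X := X) (Y := X) a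
  have h2 := hQ.dagger_unit_naturality (i := i) (X := X) (Y := X) a
  rw [← Category.assoc, h1]
  refine Eq.trans ?_ (Category.assoc _ _ _).symm
  exact (Category.assoc _ _ _).trans (congrArg (i.app X ≫ ·) h2.symm)

namespace IsQSystem

/-- `Q (i_X)` is a split monomorphism by the unit law, so `i_X` is a monomorphism when `Q` is
faithful. -/
theorem eq_zero_of_comp_unit [Q.Faithful] (S : IsQSystem Q m i) {X Y : C} {f : Y ⟶ X}
    (h : f ≫ i.app X = 0) : f = 0 := by
  apply Q.map_injective
  have h1 : Q.map f ≫ Q.map (i.app X) ≫ m.app X = Q.map (0 : Y ⟶ X) := by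
    have h0 : (0 : Y ⟶ X) ≫ i.app X = 0 := Limits.zero_comp
    have h2 : Q.map f ≫ Q.map (i.app X) = Q.map (0 : Y ⟶ X) ≫ Q.map (i.app X) := by
      rw [← Q.map_comp, ← Q.map_comp]
      exact congrArg Q.map (h.trans h0.symm)
    rw [← Category.assoc, h2, Category.assoc, S.unit_right]
    exact Category.comp_id _
  rw [S.unit_right] at h1
  exact (Category.comp_id _).symm.trans h1

/-- Multiplication by `d_Q` is injective on the finite-dimensional algebra `End X`, since
`a* ∘ d_Q ∘ a = (i_X ∘ a)* ∘ (i_X ∘ a)` and `i_X` is a monomorphism; so `d_Q` is invertible. -/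
theorem isUnit_dQ [FiniteSemisimple C] [Q.Faithful] (S : IsQSystem Q m i) (X : C) :
    IsUnit (dQ i X) := by
  have : FiniteDimensional ℂ (End X) := FiniteSemisimple.finite_hom X X
  have hinj : Function.Injective (LinearMap.mulLeft ℂ (dQ i X)) := by
    rw [← LinearMap.ker_eq_bot, LinearMap.ker_eq_bot']
    intro a ha
    have ha' : (a : X ⟶ X) ≫ i.app X ≫ dagger (i.app X) = 0 := ha
    refine S.eq_zero_of_comp_unit (f := a) (eq_zero_of_comp_dagger ?_)
    rw [dagger_comp, Category.assoc]
    have := congrArg (· ≫ dagger (X := X) (Y := X) a) ha'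
    simpa only [Category.assoc, Limits.zero_comp] using this
  obtain ⟨e, he⟩ := (LinearMap.injective_iff_surjective.1 hinj) 1
  have he' : dQ i X * e = 1 := he
  exact ⟨⟨dQ i X, e, he', ((S.starLinear.commute_dQ i e).eq).symm.trans he'⟩, rfl⟩

variable [FiniteSemisimple C] [Q.Faithful] (S : IsQSystem Q m i) (X : C)
include S

theorem dQInv_eq_inv : dQInv i X = ((S.isUnit_dQ X).unit⁻¹ : (End X)ˣ) := by
  have h : IsStarNormal ((S.isUnit_dQ X).unit : End X) :=
    (isPositive_dQ i X).isSelfAdjoint.isStarNormal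
  exact cfc_inv_id (R := ℂ) (S.isUnit_dQ X).unit h

theorem dQ_mul_dQInv : dQ i X * dQInv i X = 1 := by
  rw [S.dQInv_eq_inv]
  exact (S.isUnit_dQ X).mul_val_inv

theorem dQInv_mul_dQ : dQInv i X * dQ i X = 1 := by
  rw [S.dQInv_eq_inv]
  exact (S.isUnit_dQ X).val_inv_mul

theorem commute_dQInv (a : End X) : Commute (dQInv i X) a := by
  rw [S.dQInv_eq_inv]
  exact ((S.starLinear.commute_dQ i a).units_inv_left (u := (S.isUnit_dQ X).unit))

theorem isPositive_dQInv : IsPositive (dQInv i X) :=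
  (isPositive_dQ i X).of_mul_eq_one (S.dQ_mul_dQInv X) (S.dQInv_mul_dQ X)

end IsQSystem

/-! ### The inclusion `End X → H` and the conditional expectation -/

namespace HSpace

variable {S : IsQSystem Q m i} {X : C}

theorem emb_unitMap (a : End X) : emb (unitMap S X a) = Q.map (X := X) (Y := X) a := by
  change Q.map ((a : X ⟶ X) ≫ i.app X) ≫ m.app X = _
  rw [Q.map_comp, Category.assoc, S.unit_right]
  exact Category.comp_id _

theorem hom_unitMap_mul (a : End X) (ξ : HSpace S X) :
    hom (unitMap S X a * ξ) = hom ξ ≫ Q.map (X := X) (Y := X) a :=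
  congrArg (hom ξ ≫ ·) (emb_unitMap (S := S) a)

theorem hom_mul_unitMap (ξ : HSpace S X) (a : End X) :
    hom (ξ * unitMap S X a) = (a : X ⟶ X) ≫ hom ξ := by
  change ((a : X ⟶ X) ≫ i.app X) ≫ Q.map (hom ξ) ≫ m.app X = _
  have h := unit_naturality (i := i) (hom ξ)
  rw [Category.assoc, ← Category.assoc (i.app X), ← h, Category.assoc, S.unit_left]
  exact congrArg ((a : X ⟶ X) ≫ ·) (Category.comp_id (hom ξ))

/-- By the Frobenius law `m_X ∘ Q (η†) = (m_X ∘ Q η)*`; naturality of `i*` then moves `i_X*` past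
`Q (η*)`, and the unit law cancels it against `m_X*`. -/
theorem hom_star_mul_comp_dagger_unit (ξ η : HSpace S X) :
    hom (star η * ξ) ≫ dagger (i.app X) = inner ξ η := by
  have h : (emb (star η) : Q.obj X ⟶ Q.obj X) = dagger (m.app X) ≫ dagger (Q.map (hom η)) := by
    rw [emb_star, ← dagger_comp]
    rfl
  have h2 : dagger (Q.map (hom η)) ≫ dagger (i.app X) =
      dagger (i.app (Q.obj X)) ≫ dagger (X := X) (Y := Q.obj X) (hom η) := by
    rw [S.starLinear.dagger_unit_naturality, S.starLinear.map_dagger]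
  have h3 : dagger (m.app X) ≫ dagger (i.app (Q.obj X)) = 𝟙 _ :=
    (dagger_comp _ _).symm.trans ((congrArg dagger (S.unit_left X)).trans (dagger_id _))
  change (hom ξ ≫ (emb (star η) : Q.obj X ⟶ Q.obj X)) ≫ dagger (i.app X) = hom ξ ≫ dagger (hom η)
  rw [h, Category.assoc, Category.assoc, h2, reassoc_of% h3]

/-- `a ↦ i_X ∘ a` as a homomorphism of `*`-algebras; after `emb` it becomes `a ↦ Q a`. -/
noncomputable def unitHom (S : IsQSystem Q m i) (X : C) : End X →⋆ₐ[ℂ] HSpace S X where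
  toFun := unitMap S X
  map_one' := Category.id_comp (i.app X)
  map_mul' a b := emb_injective <| by
    rw [emb_mul, emb_unitMap, emb_unitMap, emb_unitMap]
    exact Q.map_comp (X := X) (Y := X) (Z := X) b a
  map_zero' := Limits.zero_comp
  map_add' a b := Preadditive.add_comp X X (Q.obj X) a b (i.app X)
  commutes' c := by
    rw [Algebra.algebraMap_eq_smul_one, Algebra.algebraMap_eq_smul_one]
    exact (Linear.smul_comp X X (Q.obj X) c (𝟙 X) (i.app X)).trans
      (congrArg (c • ·) (Category.id_comp (i.app X)))
  map_star' a := emb_injective <| by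
    rw [emb_star, emb_unitMap, emb_unitMap]
    exact S.starLinear.map_dagger (X := X) (Y := X) a

/-- `emb` as a homomorphism of `*`-algebras. -/
noncomputable def embStarHom (S : IsQSystem Q m i) (X : C) :
    HSpace S X →⋆ₐ[ℂ] End (Q.obj X) :=
  { embHom S X with map_star' := emb_star }

theorem unitMap_injective [Q.Faithful] : Function.Injective (unitMap S X) := by
  intro a b h
  refine Q.map_injective (X := X) (Y := X) ?_
  have := congrArg emb h
  rwa [emb_unitMap, emb_unitMap] at this

theorem condExp_star_mul (ξ η : HSpace S X) :
    condExp S X (star η * ξ) = dQInv i X * inner ξ η :=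
  congrArg (dQInv i X * ·) (hom_star_mul_comp_dagger_unit ξ η)

/-- Since `m_X` is a coisometry, `ξ† · ξ ≤ Q ⟨ξ, ξ⟩` inside `End (Q X)`. -/
theorem isPositive_map_inner_sub_emb (c : HSpace S X) :
    IsPositive (End.of (Q.map (X := X) (Y := X) (inner c c)) - emb (star c * c)) := by
  have h := isPositive_comp_dagger_sub (Q.map (hom c)) (m.app X) (S.separable X)
  rw [← S.starLinear.map_dagger, ← Q.map_comp] at h
  rw [emb_mul, emb_star]
  exact h

variable [FiniteSemisimple C] [Q.Faithful]

theorem isCondExp_condExp : IsCondExp (unitHom S X) (condExp S X) where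
  map_add x y := by
    refine Eq.trans ?_ (mul_add (dQInv i X) _ _)
    exact congrArg (dQInv i X * ·) (Preadditive.add_comp _ _ _ (hom x) (hom y) (dagger (i.app X)))
  map_smul c x := by
    refine Eq.trans ?_ (mul_smul_comm c (dQInv i X) _)
    exact congrArg (dQInv i X * ·) (Linear.smul_comp _ _ _ c (hom x) (dagger (i.app X)))
  map_inclusion a := by
    have h : ((a : X ⟶ X) ≫ i.app X) ≫ dagger (i.app X) = dQ i X * a :=
      Category.assoc _ _ _
    change dQInv i X * End.of (((a : X ⟶ X) ≫ i.app X) ≫ dagger (i.app X)) = a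
    have h' : End.of (((a : X ⟶ X) ≫ i.app X) ≫ dagger (i.app X)) = dQ i X * a := h
    rw [h', ← mul_assoc, S.dQInv_mul_dQ, one_mul]
  bimodule a x b := by
    have h : hom (unitHom S X a * x * unitHom S X b) ≫ dagger (i.app X) =
        (a * (End.of (hom x ≫ dagger (i.app X)) * b) : End X) := by
      have h1 := hom_mul_unitMap (unitMap S X a * x) b
      have h2 := S.starLinear.dagger_unit_naturality (i := i) (X := X) (Y := X) a
      rw [hom_unitMap_mul] at h1
      refine (congrArg (· ≫ dagger (i.app X)) h1).trans ?_
      rw [Category.assoc, Category.assoc, ← h2]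
      change _ = ((b : X ⟶ X) ≫ hom x ≫ dagger (i.app X)) ≫ (a : X ⟶ X)
      rw [Category.assoc, Category.assoc]
    have h' : End.of (hom (unitHom S X a * x * unitHom S X b) ≫ dagger (i.app X)) =
      a * (End.of (hom x ≫ dagger (i.app X)) * b) := h
    change dQInv i X * End.of (hom (unitHom S X a * x * unitHom S X b) ≫ dagger (i.app X)) =
      a * (dQInv i X * End.of (hom x ≫ dagger (i.app X))) * b
    rw [h', ← mul_assoc, (S.commute_dQInv X a).eq, mul_assoc, mul_assoc, mul_assoc]
  positive x hx := by
    obtain ⟨c, rfl⟩ := hx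
    rw [condExp_star_mul]
    exact (S.isPositive_dQInv X).mul_of_commute (isPositive_comp_dagger (hom c))
      (S.commute_dQInv X _)

theorem isFaithful_condExp : IsFaithful (condExp S X) := by
  rintro x ⟨c, rfl⟩ h
  rw [condExp_star_mul] at h
  have h0 : inner c c = 0 := by
    rw [← one_mul (inner c c), ← S.dQ_mul_dQInv X, mul_assoc, h, mul_zero]
  have hc : c = 0 := eq_zero_of_comp_dagger (f := hom c) h0
  rw [hc, mul_zero]

theorem hasFiniteIndex_condExp : HasFiniteIndex (unitHom S X) (condExp S X) := by
  refine ⟨‖dQ i X‖ + 1, by positivity, ?_⟩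
  rintro x ⟨c, rfl⟩
  refine IsPositive.of_map (embStarHom S X) emb_injective ?_
  set K : ℂ := ((‖dQ i X‖ + 1 : ℝ) : ℂ) with hK
  -- `K • Q (E x) - emb x` splits as `Q (K • d⁻¹ ⟨c, c⟩ - ⟨c, c⟩) + (Q ⟨c, c⟩ - emb x)`.
  have h1 := S.starLinear.isPositive_map <|
    (isPositive_dQ i X).smul_inv_mul_sub (isPositive_comp_dagger (hom c))
      (S.dQ_mul_dQInv X) (S.dQInv_mul_dQ X) (S.starLinear.commute_dQ i _) (S.commute_dQInv X _)
  have h2 := h1.add (isPositive_map_inner_sub_emb c)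
  convert h2 using 1
  rw [map_sub, map_smul, condExp_star_mul]
  change K • emb (unitMap S X _) - emb (star c * c) = _
  rw [emb_unitMap]
  have h3 : End.of (Q.map (X := X) (Y := X)
      (K • (dQInv i X * inner c c) - inner c c)) =
        K • End.of (Q.map (X := X) (Y := X) (dQInv i X * inner c c)) -
          End.of (Q.map (X := X) (Y := X) (inner c c)) :=
    (S.starLinear.map_sub _ _).trans (congrArg (· - Q.map (X := X) (Y := X) (inner c c))
      (S.starLinear.map_smul (X := X) (Y := X) K (dQInv i X * inner c c)))
  exact (sub_add_sub_cancel _ _ _).symm.trans (congrArg (· + _) h3.symm)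

end HSpace

end QSystems

end UC

open UC in
theorem mainTheorem3 {M : ℕ → Type u} [∀ k, Category.{v} (M k)] [∀ k, Preadditive (M k)]
    [∀ k, Linear ℂ (M k)] [∀ k, CStarCategory (M k)] [∀ k, FiniteSemisimple (M k)]
    (Γ : ZeroCell M) (m₀ : M 0) (hm₀ : IsSumOfAllSimples m₀) (Q : QSystem Γ)
    (l : ℕ) (hl : ∀ k ≥ l, QSystemAt Q.cell Q.mul Q.unit k) (k : ℕ) (hk : l ≤ k) :
    ∃ ι : End (Γ.obj m₀ k) →⋆ₐ[ℂ] HSpace (hl k hk).isQSystem (Γ.obj m₀ k),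
      (∀ a, ι a = HSpace.unitMap (hl k hk).isQSystem (Γ.obj m₀ k) a) ∧
      Function.Injective ι ∧
      IsCondExp ι (HSpace.condExp (hl k hk).isQSystem (Γ.obj m₀ k)) ∧
      IsFaithful (HSpace.condExp (hl k hk).isQSystem (Γ.obj m₀ k)) ∧
      HasFiniteIndex ι (HSpace.condExp (hl k hk).isQSystem (Γ.obj m₀ k)) ∧
      ∀ ξ η : HSpace (hl k hk).isQSystem (Γ.obj m₀ k),
        HSpace.condExp (hl k hk).isQSystem (Γ.obj m₀ k) (star η * ξ) =
          dQInv (Q.unit k) (Γ.obj m₀ k) * HSpace.inner ξ η := by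
  have : (Q.cell.functor k).Faithful := (Q.cell.biFaithful k).1
  exact ⟨HSpace.unitHom _ _, fun _ => rfl, HSpace.unitMap_injective, HSpace.isCondExp_condExp,
    HSpace.isFaithful_condExp, HSpace.hasFiniteIndex_condExp, HSpace.condExp_star_mul⟩
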